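/- Let $q$ be a positive integer. An instance of $\mathsf{UG}(q)$ is encoded as a finite nonempty relational structure $\mathbb A$ over the vocabulary $\tau_{\mathsf{UG}(q)}$ that has one binary relation symbol $P_\pi$ for each permutation $\pi$ of the label set $[q]$: the universe $A$ is the set of variables, and $(u,v)\in P_\pi^{\mathbb A}$ imposes the constraint that the label of $v$ is the image under $\pi$ of the label of $u$. The instance is completely satisfiable if there is $f\colon A\to[q]$ with $f(v)=\pi(f(u))$ for all $\pi$ and all $(u,v)\in P_\pi^{\mathbb A}$. Let LFP be first-order logic extended by least fixed points $[\mathrm{lfp}\,X(x_1,\dots,x_n).\,\psi](t_1,\dots,t_n)$ of formulas $\psi$ in which the relation variable $X$ occurs only positively, and let $C^k$ be the infinitary first-order logic with counting quantifiers $\exists^{\ge m}x$ in which only $k$ distinct variables are used. For an LFP sentence $\varphi$, let $\mu(\varphi)$ be the least $k$ such that some sentence of $C^k$ is satisfied by exactly the same finite nonempty structures as $\varphi$. Then there is an LFP sentence $\varphi$ over $\tau_{\mathsf{UG}(q)}$ such that, for every finite nonempty $\tau_{\mathsf{UG}(q)}$-structure $\mathbb A$, $$\mathbb A\models\varphi\iff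 \mathbb A\text{ is completely satisfiable},$$ and $\mu(\varphi)\le 3$, with $\mu(\varphi)=3$ whenever $q\ge 2$. -/

import Mathlib

/-! ### Least fixed point logic over a relational vocabulary -/

/-- Raw formulas of least fixed point logic over the relation symbols of `L` (the vocabularies
considered are relational, so the only terms are variables). Individual variables are named by
natural numbers, and a relation variable is given by its arity together with its name. -/
inductive LFPFormula (L : FirstOrder.Language.{0, 0}) : Type
  | eq (x y : ℕ) : LFPFormula L
  | rel {n : ℕ} (R : L.Relations n) (x : Fin n → ℕ) : LFPFormula L
  | relVar (n X : ℕ) (x : Fin n → ℕ) : LFPFormula L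
  | neg (φ : LFPFormula L) : LFPFormula L
  | and (φ ψ : LFPFormula L) : LFPFormula L
  | or (φ ψ : LFPFormula L) : LFPFormula L
  | ex (x : ℕ) (φ : LFPFormula L) : LFPFormula L
  | all (x : ℕ) (φ : LFPFormula L) : LFPFormula L
  /-- `[lfp X(x₁, …, xₙ). φ](t₁, …, tₙ)`, with `X` a relation variable of arity `n`. -/
  | lfp (n X : ℕ) (x : Fin n → ℕ) (φ : LFPFormula L) (t : Fin n → ℕ) : LFPFormula L

namespace LFPFormula

variable {L : FirstOrder.Language.{0, 0}}

/-- The free individual variables. -/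
def freeVars : LFPFormula L → Set ℕ
  | eq x y => {x, y}
  | rel _ x => Set.range x
  | relVar _ _ x => Set.range x
  | neg φ => φ.freeVars
  | and φ ψ => φ.freeVars ∪ ψ.freeVars
  | or φ ψ => φ.freeVars ∪ ψ.freeVars
  | ex x φ => φ.freeVars \ {x}
  | all x φ => φ.freeVars \ {x}
  | lfp _ _ x φ t => (φ.freeVars \ Set.range x) ∪ Set.range t

/-- The free relation variables, as pairs (arity, name). -/
def freeRelVars : LFPFormula L → Set (ℕ × ℕ)
  | eq _ _ => ∅
  | rel _ _ => ∅
  | relVar n X _ => {(n, X)}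
  | neg φ => φ.freeRelVars
  | and φ ψ => φ.freeRelVars ∪ ψ.freeRelVars
  | or φ ψ => φ.freeRelVars ∪ ψ.freeRelVars
  | ex _ φ => φ.freeRelVars
  | all _ φ => φ.freeRelVars
  | lfp n X _ φ _ => φ.freeRelVars \ {(n, X)}

/-- `φ.HasPolarity n X b`: every free occurrence in `φ` of the `n`-ary relation variable `X` is
positive, that is, under an even number of negations (if `b = true`), respectively negative, that
is, under an odd number of negations (if `b = false`). -/
def HasPolarity (n X : ℕ) : Bool → LFPFormula L → Prop
  | _, eq _ _ => True
  | _, rel _ _ => True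
  | b, relVar m Y _ => (m = n ∧ Y = X) → b = true
  | b, neg φ => HasPolarity n X (!b) φ
  | b, and φ ψ => HasPolarity n X b φ ∧ HasPolarity n X b ψ
  | b, or φ ψ => HasPolarity n X b φ ∧ HasPolarity n X b ψ
  | b, ex _ φ => HasPolarity n X b φ
  | b, all _ φ => HasPolarity n X b φ
  | b, lfp m Y _ φ _ => (m = n ∧ Y = X) ∨ HasPolarity n X b φ

/-- Well-formedness: in each subformula `[lfp X(x₁, …, xₙ). φ](t₁, …, tₙ)` the variables
`x₁, …, xₙ` are distinct and `X` occurs only positively in `φ`. -/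
def WellFormed : LFPFormula L → Prop
  | eq _ _ => True
  | rel _ _ => True
  | relVar _ _ _ => True
  | neg φ => φ.WellFormed
  | and φ ψ => φ.WellFormed ∧ ψ.WellFormed
  | or φ ψ => φ.WellFormed ∧ ψ.WellFormed
  | ex _ φ => φ.WellFormed
  | all _ φ => φ.WellFormed
  | lfp n X x φ _ => Function.Injective x ∧ φ.HasPolarity n X true ∧ φ.WellFormed

/-- Satisfaction in the structure `A`, where `ρ n X` is the value of the `n`-ary relation variable
`X` and `v x` is the value of the individual variable `x`. In the last clause the operator
`S ↦ {a | φ holds for X := S and (x₁, …, xₙ) := a}` is monotone when `X` occurs only positively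
in `φ`, and then the intersection of all `S` that are closed under it is its least fixed point. -/
def Realize {A : Type} [L.Structure A] :
    LFPFormula L → ((n : ℕ) → ℕ → Set (Fin n → A)) → (ℕ → A) → Prop
  | eq x y, _, v => v x = v y
  | rel R x, _, v => FirstOrder.Language.Structure.RelMap R (fun i => v (x i))
  | relVar n X x, ρ, v => (fun i => v (x i)) ∈ ρ n X
  | neg φ, ρ, v => ¬ φ.Realize ρ v
  | and φ ψ, ρ, v => φ.Realize ρ v ∧ ψ.Realize ρ v
  | or φ ψ, ρ, v => φ.Realize ρ v ∨ ψ.Realize ρ v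
  | ex x φ, ρ, v => ∃ a : A, φ.Realize ρ (Function.update v x a)
  | all x φ, ρ, v => ∀ a : A, φ.Realize ρ (Function.update v x a)
  | lfp n X x φ t, ρ, v =>
      (fun i => v (t i)) ∈ ⋂₀ {S : Set (Fin n → A) |
        {a : Fin n → A | φ.Realize (Function.update ρ n (Function.update (ρ n) X S))
          (Function.extend x a v)} ⊆ S}

end LFPFormula

/-- Sentences of LFP: well-formed formulas without free individual or relation variables. -/
structure LFPSentence (L : FirstOrder.Language.{0, 0}) where
  formula : LFPFormula L
  wellFormed : formula.WellFormed
  freeVars_eq : formula.freeVars = ∅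
  freeRelVars_eq : formula.freeRelVars = ∅

/-- `A ⊨ φ` for a nonempty structure `A`. The values of the variables are irrelevant, since `φ` has
no free ones. -/
def LFPSentence.Models {L : FirstOrder.Language.{0, 0}} (φ : LFPSentence L) (A : Type) [L.Structure A] :
    Prop :=
  ∀ (ρ : (n : ℕ) → ℕ → Set (Fin n → A)) (v : ℕ → A), φ.formula.Realize ρ v

/-! ### Infinitary counting logic with `k` variables -/

/-- Formulas of `C^k`, infinitary first-order logic with counting quantifiers whose only variables
are the `k` variables named by `Fin k`. Conjunctions and disjunctions are over arbitrary (also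
empty or infinite) families, and `exGe m x φ` is the counting quantifier "there are at least `m`
elements `x` such that `φ`" (for `m = 1` it is the ordinary `∃ x`). -/
inductive CFormula (L : FirstOrder.Language.{0, 0}) (k : ℕ) : Type 1
  | eq (x y : Fin k) : CFormula L k
  | rel {n : ℕ} (R : L.Relations n) (x : Fin n → Fin k) : CFormula L k
  | neg (φ : CFormula L k) : CFormula L k
  | iAnd {ι : Type} (φ : ι → CFormula L k) : CFormula L k
  | iOr {ι : Type} (φ : ι → CFormula L k) : CFormula L k
  | exGe (m : ℕ) (x : Fin k) (φ : CFormula L k) : CFormula L k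

namespace CFormula

variable {L : FirstOrder.Language.{0, 0}} {k : ℕ}

/-- The free variables. -/
def freeVars : CFormula L k → Set (Fin k)
  | eq x y => {x, y}
  | rel _ x => Set.range x
  | neg φ => φ.freeVars
  | iAnd φ => ⋃ i, (φ i).freeVars
  | iOr φ => ⋃ i, (φ i).freeVars
  | exGe _ x φ => φ.freeVars \ {x}

/-- Satisfaction in the structure `A` under the assignment `v`. -/
def Realize {A : Type} [L.Structure A] : CFormula L k → (Fin k → A) → Prop
  | eq x y, v => v x = v y
  | rel R x, v => FirstOrder.Language.Structure.RelMap R (fun i => v (x i))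
  | neg φ, v => ¬ φ.Realize v
  | iAnd φ, v => ∀ i, (φ i).Realize v
  | iOr φ, v => ∃ i, (φ i).Realize v
  | exGe m x φ, v => (m : ℕ∞) ≤ {a : A | φ.Realize (Function.update v x a)}.encard

end CFormula

/-- Sentences of `C^k`. -/
structure CSentence (L : FirstOrder.Language.{0, 0}) (k : ℕ) where
  formula : CFormula L k
  freeVars_eq : formula.freeVars = ∅

/-- `A ⊨ ψ` for a nonempty structure `A`. -/
def CSentence.Models {L : FirstOrder.Language.{0, 0}} {k : ℕ} (ψ : CSentence L k) (A : Type)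
    [L.Structure A] : Prop :=
  ∀ v : Fin k → A, ψ.formula.Realize v

/-- `φ` can be translated into `C^k`: some sentence of `C^k` has the same finite models
(structures are nonempty). -/
def LFPSentence.TranslatableInto {L : FirstOrder.Language.{0, 0}} (φ : LFPSentence L) (k : ℕ) : Prop :=
  ∃ ψ : CSentence L k,
    ∀ (A : Type) [L.Structure A] [Finite A] [Nonempty A], φ.Models A ↔ ψ.Models A

/-- `μ(φ)`: the least `k` such that `φ` can be translated into `C^k` (`⊤` if there is none). -/
noncomputable def LFPSentence.mu {L : FirstOrder.Language.{0, 0}} (φ : LFPSentence L) : ℕ∞ :=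
  sInf ((fun k : ℕ => (k : ℕ∞)) '' {k : ℕ | φ.TranslatableInto k})

/-! ### Unique games -/

/-- The relation symbols for unique games with label set `Fin q`: one binary symbol `P_π` for each
permutation `π` of the labels. -/
inductive UGRel (q : ℕ) : ℕ → Type
  | P (π : Equiv.Perm (Fin q)) : UGRel q 2

/-- The relational vocabulary of (unweighted) `UG(q)` instances. -/
def ugLang (q : ℕ) : FirstOrder.Language.{0, 0} where
  Functions := fun _ => Empty
  Relations := UGRel q

/-- The elements of the structure `A` are the variables of the instance, and `P_π(u, v)` imposes the
constraint that the label of `v` is the image under `π` of the label of `u`. The instance is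
completely satisfiable if some labelling satisfies all the constraints. -/
def CompletelySatisfiable (q : ℕ) (A : Type) [(ugLang q).Structure A] : Prop :=
  ∃ f : A → Fin q, ∀ (π : Equiv.Perm (Fin q)) (u v : A),
    FirstOrder.Language.Structure.RelMap (L := ugLang q) (UGRel.P π) ![u, v] → f v = π (f u)

/-! Constraints are permutations, so a label chosen at one variable propagates deterministically
along walks. An instance fails to be completely satisfiable exactly when at some variable every
label is carried by a closed walk to a different label. This condition, `Conflict`, is reachability
in a graph on `A × Fin q` (`completelySatisfiable_iff`).

Reachability between the `q` layers is LFP-definable by eliminating layers as in Kleene's algorithm.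
It is `C^3`-definable as the disjunction over all walk lengths, because relations are composed with
one auxiliary variable. Both logics define the same `Conflict`, so the bound `μ ≤ 3` needs no
general translation of LFP.

For the lower bound, `C^2` cannot tell apart two fixed-point-free permutations without 2-cycles on
sets of equal finite size: the bijective 2-pebble game sees only an element, its successor and its
predecessor. One long cycle and several short cycles with opposite satisfiability therefore agree in
`C^2`. -/

/-! ### Binary relations definable in LFP -/

section Definability

variable {L : FirstOrder.Language.{0, 0}}

/-- A uniform family of binary relations is LFP-definable if it is defined, at all choices of the
two variables, by a well-formed formula without free relation variables. -/
def LFPDefinable (L : FirstOrder.Language.{0, 0})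
    (R : ∀ (A : Type) [L.Structure A], A → A → Prop) : Prop :=
  ∀ x y : ℕ, ∃ φ : LFPFormula L, φ.WellFormed ∧ (∀ n X b, φ.HasPolarity n X b) ∧
    φ.freeVars ⊆ {x, y} ∧ φ.freeRelVars = ∅ ∧
    ∀ (A : Type) [L.Structure A] (ρ : (n : ℕ) → ℕ → Set (Fin n → A)) (v : ℕ → A),
      φ.Realize ρ v ↔ R A (v x) (v y)

namespace LFPDefinable

variable {R S : ∀ (A : Type) [L.Structure A], A → A → Prop}

theorem equal : LFPDefinable L (fun _ _ u v => u = v) := fun x y =>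
  ⟨.eq x y, trivial, fun _ _ _ => by simp [LFPFormula.HasPolarity], subset_rfl, rfl,
    fun _ _ _ _ => Iff.rfl⟩

theorem relation (P : L.Relations 2) :
    LFPDefinable L (fun _ _ u v => FirstOrder.Language.Structure.RelMap P ![u, v]) := fun x y => by
  refine ⟨.rel P ![x, y], trivial, fun _ _ _ => by simp [LFPFormula.HasPolarity], ?_, rfl, ?_⟩
  · rintro _ ⟨i, rfl⟩
    fin_cases i <;> simp
  · intro A _ ρ v
    have : (fun i => v (![x, y] i)) = ![v x, v y] := by
      funext i; fin_cases i <;> rfl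
    simp [LFPFormula.Realize, this]

theorem swap (hR : LFPDefinable L R) : LFPDefinable L (fun A _ u v => R A v u) := fun x y => by
  obtain ⟨φ, h⟩ := hR y x
  exact ⟨φ, by rwa [Set.pair_comm x y]⟩

theorem not (hR : LFPDefinable L R) : LFPDefinable L (fun A _ u v => ¬ R A u v) := fun x y => by
  obtain ⟨φ, h1, h2, h3, h4, h5⟩ := hR x y
  exact ⟨.neg φ, h1, fun n X b => by simpa [LFPFormula.HasPolarity] using h2 n X (!b), h3, h4,
    fun A _ ρ v => not_congr (h5 A ρ v)⟩

theorem or (hR : LFPDefinable L R) (hS : LFPDefinable L S) :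
    LFPDefinable L (fun A _ u v => R A u v ∨ S A u v) := fun x y => by
  obtain ⟨φ, h1, h2, h3, h4, h5⟩ := hR x y
  obtain ⟨ψ, k1, k2, k3, k4, k5⟩ := hS x y
  exact ⟨.or φ ψ, ⟨h1, k1⟩, fun n X b => ⟨h2 n X b, k2 n X b⟩, Set.union_subset h3 k3,
    by simp [LFPFormula.freeRelVars, h4, k4], fun A _ ρ v => or_congr (h5 A ρ v) (k5 A ρ v)⟩

theorem and (hR : LFPDefinable L R) (hS : LFPDefinable L S) :
    LFPDefinable L (fun A _ u v => R A u v ∧ S A u v) := by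
  simpa [not_or] using (hR.not.or hS.not).not

theorem const (p : Prop) : LFPDefinable L (fun _ _ _ _ => p) := by
  have h : LFPDefinable L (fun _ _ u v => u = v ∨ ¬ u = v) := equal.or equal.not
  by_cases hp : p
  · simpa [hp, em] using h
  · simpa [hp, em] using h.not

theorem exists_mem {ι : Type} {R : ι → ∀ (A : Type) [L.Structure A], A → A → Prop}
    (hR : ∀ i, LFPDefinable L (R i)) (s : Finset ι) :
    LFPDefinable L (fun A _ u v => ∃ i ∈ s, R i A u v) := by
  classical
  induction s using Finset.induction_on with
  | empty => simpa using const (L := L) False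
  | insert a s _ ih => simpa using (hR a).or ih

theorem iUnion {ι : Type} [Finite ι] {R : ι → ∀ (A : Type) [L.Structure A], A → A → Prop}
    (hR : ∀ i, LFPDefinable L (R i)) : LFPDefinable L (fun A _ u v => ∃ i, R i A u v) := by
  have := Fintype.ofFinite ι
  simpa using exists_mem hR Finset.univ

theorem iInter {ι : Type} [Finite ι] {R : ι → ∀ (A : Type) [L.Structure A], A → A → Prop}
    (hR : ∀ i, LFPDefinable L (R i)) : LFPDefinable L (fun A _ u v => ∀ i, R i A u v) := by
  simpa using (iUnion fun i => (hR i).not).not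

theorem comp (hR : LFPDefinable L R) (hS : LFPDefinable L S) :
    LFPDefinable L (fun A _ u v => ∃ w, R A u w ∧ S A w v) := fun x y => by
  obtain ⟨z, hzx, hzy⟩ : ∃ z : ℕ, x ≠ z ∧ y ≠ z := ⟨x + y + 1, by omega, by omega⟩
  obtain ⟨φ, h1, h2, h3, h4, h5⟩ := hR x z
  obtain ⟨ψ, k1, k2, k3, k4, k5⟩ := hS z y
  refine ⟨.ex z (.and φ ψ), ⟨h1, k1⟩, fun n X b => ⟨h2 n X b, k2 n X b⟩, ?_,
    by simp [LFPFormula.freeRelVars, h4, k4], fun A _ ρ v => ?_⟩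
  · rintro a ⟨ha | ha, haz⟩
    · have := h3 ha
      simp_all
    · have := k3 ha
      simp_all
  · simp [LFPFormula.Realize, h5, k5, Function.update_of_ne hzx, Function.update_of_ne hzy]

theorem reflTransGen (hR : LFPDefinable L R) :
    LFPDefinable L (fun A _ u v => Relation.ReflTransGen (R A) u v) := fun x y => by
  -- Only `x` is a parameter of the fixed-point body; `y` occurs outside its scope, so `z` or `w`
  -- may coincide with it.
  obtain ⟨z, w, hzx, hwx, hwz⟩ : ∃ z w : ℕ, x ≠ z ∧ x ≠ w ∧ z ≠ w :=
    ⟨x + 1, x + 2, by omega, by omega, by omega⟩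
  obtain ⟨φ, h1, h2, h3, h4, h5⟩ := hR w z
  -- The fixed point is the set of points reachable from `x`. Nested uses may share the relation
  -- variable `(1, 0)`, since `φ` has none free.
  refine ⟨.lfp 1 0 (fun _ => z) (.or (.eq z x) (.ex w (.and (.relVar 1 0 fun _ => w) φ)))
    (fun _ => y), ?_, ?_, ?_, ?_, fun A _ ρ v => ?_⟩
  · exact ⟨Function.injective_of_subsingleton _,
      ⟨by simp [LFPFormula.HasPolarity], by simp [LFPFormula.HasPolarity], h2 _ _ _⟩,
      trivial, trivial, h1⟩
  · intro n X b
    by_cases hX : 1 = n ∧ 0 = X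
    · exact Or.inl hX
    · exact Or.inr ⟨by simp [LFPFormula.HasPolarity], fun h => absurd h hX, h2 _ _ _⟩
  · rintro a (⟨(ha | ⟨ha | ha, haw⟩), haz⟩ | ha)
    · exact Or.inl ((Set.mem_insert_iff.1 ha).resolve_left fun h => haz ⟨0, h.symm⟩)
    · obtain ⟨_, rfl⟩ := ha
      exact absurd rfl haw
    · have := h3 ha
      simp_all
    · simp_all
  · simp [LFPFormula.freeRelVars, h4]
  · have hext : ∀ a : Fin 1 → A, Function.extend (fun _ : Fin 1 => z) a v
        = Function.update v z (a 0) := fun a => by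
      funext b
      by_cases hb : b = z
      · subst hb
        rw [Function.update_self]
        exact (Function.injective_of_subsingleton (fun _ : Fin 1 => b)).extend_apply a v 0
      · rw [Function.update_of_ne hb, Function.extend_apply']
        rintro ⟨_, h⟩
        exact hb h.symm
    simp only [LFPFormula.Realize, hext, h5, Function.update_self, Function.update_of_ne hzx,
      Function.update_of_ne hwz, Set.mem_sInter, Set.mem_ofPred_eq]
    constructor
    · intro h
      refine h {a | Relation.ReflTransGen (R A) (v x) (a 0)} ?_
      rintro a (ha | ⟨b, hb, hba⟩)
      · rw [Set.mem_ofPred_eq, ha]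
      · exact Relation.ReflTransGen.tail hb hba
    · intro h S hS
      generalize v y = b at h
      induction h with
      | refl => exact hS (Or.inl rfl)
      | tail _ hbc ih => exact hS (Or.inr ⟨_, ih, hbc⟩)

/-- Emptiness of an LFP-definable relation is expressible. -/
theorem exists_sentence_not (hR : LFPDefinable L R) : ∃ φ : LFPSentence L,
    ∀ (A : Type) [L.Structure A] [Nonempty A], φ.Models A ↔ ¬ ∃ u v, R A u v := by
  obtain ⟨φ, h1, _, h3, h4, h5⟩ := hR 0 1
  refine ⟨⟨.neg (.ex 0 (.ex 1 φ)), h1, ?_, h4⟩, fun A _ _ => ?_⟩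
  · refine Set.eq_empty_of_forall_notMem ?_
    rintro a ⟨⟨ha, ha1⟩, ha0⟩
    have := h3 ha
    simp_all
  · have : ∀ (ρ : (n : ℕ) → ℕ → Set (Fin n → A)) (v : ℕ → A),
        (LFPFormula.neg (.ex 0 (.ex 1 φ))).Realize ρ v ↔ ¬ ∃ u v, R A u v := fun ρ v => by
      simp [LFPFormula.Realize, h5]
    exact ⟨fun h => (this (fun _ _ => ∅) (fun _ => Classical.arbitrary A)).1 (h _ _),
      fun h ρ v => (this ρ v).2 h⟩

/-- Transitive closures of graphs on `A × ι` whose edge relations between the layers are definable: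
the layers are eliminated one after the other. -/
theorem transGen_prod {ι : Type} [Finite ι]
    {E : ∀ (A : Type) [L.Structure A], A × ι → A × ι → Prop}
    (hE : ∀ i j, LFPDefinable L (fun A _ u v => E A (u, i) (v, j))) (i j : ι) :
    LFPDefinable L (fun A _ u v => Relation.TransGen (E A) (u, i) (v, j)) := by
  classical
  have := Fintype.ofFinite ι
  -- `T` lies between `E` and its transitive closure and composes through every midpoint in a layer
  -- of `s`. Once `s` contains all layers, `T` is transitive and hence equals the closure.
  have key : ∀ s : Finset ι, ∃ T : ∀ (A : Type) [L.Structure A], A × ι → A × ι → Prop,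
      (∀ i j, LFPDefinable L (fun A _ u v => T A (u, i) (v, j))) ∧
      ∀ (A : Type) [L.Structure A], (∀ p r, E A p r → T A p r) ∧
        (∀ p r, T A p r → Relation.TransGen (E A) p r) ∧
        ∀ p m r, m.2 ∈ s → T A p m → T A m r → T A p r := by
    intro s
    induction s using Finset.induction_on with
    | empty => exact ⟨E, hE, fun A _ => ⟨fun _ _ h => h, fun _ _ h => .single h, by simp⟩⟩
    | insert k s _ ih =>
      obtain ⟨T, hT, h⟩ := ih
      refine ⟨fun A _ p r => T A p r ∨ ∃ m, T A p (m, k) ∧ ∃ m',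
        Relation.ReflTransGen (fun u v => T A (u, k) (v, k)) m m' ∧ T A (m', k) r,
        fun i j => (hT i j).or ((hT i k).comp ((hT k k).reflTransGen.comp (hT k j))),
        fun A _ => ?_⟩
      obtain ⟨h1, h2, h3⟩ := h A
      have step : ∀ {m m' : A}, Relation.ReflTransGen (fun u v => T A (u, k) (v, k)) m m' →
          Relation.ReflTransGen (E A) (m, k) (m', k) := fun hm => by
        induction hm with
        | refl => exact .refl
        | tail _ hbc ih => exact ih.trans (h2 _ _ hbc).to_reflTransGen
      refine ⟨fun p r hpr => Or.inl (h1 _ _ hpr), ?_, ?_⟩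
      · rintro p r (hpr | ⟨m, hpm, m', hmm, hmr⟩)
        · exact h2 _ _ hpr
        · exact ((h2 _ _ hpm).trans_left (step hmm)).trans (h2 _ _ hmr)
      · rintro p ⟨m, l⟩ r hl hp hr
        by_cases hlk : l = k
        · subst hlk
          -- The midpoint lies in the new layer: both halves are normalised to one step into or out
          -- of that layer and a walk inside it, and the two inner walks are concatenated.
          obtain ⟨a, hpa, ham⟩ : ∃ a, T A p (a, l) ∧
              Relation.ReflTransGen (fun u v => T A (u, l) (v, l)) a m := by
            rcases hp with hp | ⟨a, ha, b, hab, hb⟩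
            · exact ⟨m, hp, .refl⟩
            · exact ⟨a, ha, hab.tail hb⟩
          obtain ⟨c, hmc, hcr⟩ : ∃ c, Relation.ReflTransGen (fun u v => T A (u, l) (v, l)) m c ∧
              T A (c, l) r := by
            rcases hr with hr | ⟨a, ha, b, hab, hb⟩
            · exact ⟨m, .refl, hr⟩
            · exact ⟨b, hab.head ha, hb⟩
          exact Or.inr ⟨a, hpa, c, ham.trans hmc, hcr⟩
        · have hs : l ∈ s := (Finset.mem_insert.1 hl).resolve_left hlk
          rcases hp with hp | ⟨a, ha, b, hab, hb⟩ <;> rcases hr with hr | ⟨c, hc, d, hcd, hd⟩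
          · exact Or.inl (h3 _ _ _ hs hp hr)
          · exact Or.inr ⟨c, h3 _ _ _ hs hp hc, d, hcd, hd⟩
          · exact Or.inr ⟨a, ha, b, hab, h3 _ _ _ hs hb hr⟩
          · exact Or.inr ⟨a, ha, d, (hab.tail (h3 _ _ _ hs hb hc)).trans hcd, hd⟩
  obtain ⟨T, hT, h⟩ := key Finset.univ
  convert hT i j using 6 with A _ u v
  obtain ⟨h1, h2, h3⟩ := h A
  refine ⟨fun huv => ?_, h2 _ _⟩
  generalize (v, j) = r at huv
  induction huv with
  | single h => exact h1 _ _ h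
  | tail _ hbc ih => exact h3 _ _ _ (Finset.mem_univ _) ih (h1 _ _ hbc)

end LFPDefinable

/-! ### Binary relations definable in `C^3` -/

/-- A uniform family of binary relations is `C^3`-definable if it is defined, at all choices of two
distinct variables, by a formula of `C^3`. -/
def CDefinable (L : FirstOrder.Language.{0, 0})
    (R : ∀ (A : Type) [L.Structure A], A → A → Prop) : Prop :=
  ∀ x y : Fin 3, x ≠ y → ∃ φ : CFormula L 3, φ.freeVars ⊆ {x, y} ∧
    ∀ (A : Type) [L.Structure A] (v : Fin 3 → A), φ.Realize v ↔ R A (v x) (v y)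

theorem CFormula.realize_exGe_one {k : ℕ} {A : Type} [L.Structure A] (x : Fin k)
    (φ : CFormula L k) (v : Fin k → A) :
    (CFormula.exGe 1 x φ).Realize v ↔ ∃ a, φ.Realize (Function.update v x a) := by
  simp [CFormula.Realize, Set.one_le_encard_iff_nonempty, Set.Nonempty]

namespace CDefinable

variable {R S : ∀ (A : Type) [L.Structure A], A → A → Prop}

theorem equal : CDefinable L (fun _ _ u v => u = v) := fun x y _ =>
  ⟨.eq x y, subset_rfl, fun _ _ _ => Iff.rfl⟩

theorem relation (P : L.Relations 2) :
    CDefinable L (fun _ _ u v => FirstOrder.Language.Structure.RelMap P ![u, v]) := fun x y _ => by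
  refine ⟨.rel P ![x, y], ?_, ?_⟩
  · rintro _ ⟨i, rfl⟩
    fin_cases i <;> simp
  · intro A _ v
    have : (fun i => v (![x, y] i)) = ![v x, v y] := by
      funext i; fin_cases i <;> rfl
    simp [CFormula.Realize, this]

theorem swap (hR : CDefinable L R) : CDefinable L (fun A _ u v => R A v u) := fun x y hxy => by
  obtain ⟨φ, h⟩ := hR y x hxy.symm
  exact ⟨φ, by rwa [Set.pair_comm x y]⟩

theorem not (hR : CDefinable L R) : CDefinable L (fun A _ u v => ¬ R A u v) := fun x y hxy => by
  obtain ⟨φ, h3, h5⟩ := hR x y hxy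
  exact ⟨.neg φ, h3, fun A _ v => not_congr (h5 A v)⟩

theorem iUnion {ι : Type} {R : ι → ∀ (A : Type) [L.Structure A], A → A → Prop}
    (hR : ∀ i, CDefinable L (R i)) : CDefinable L (fun A _ u v => ∃ i, R i A u v) := fun x y hxy => by
  choose φ h3 h5 using fun i => hR i x y hxy
  exact ⟨.iOr φ, Set.iUnion_subset h3, fun A _ v => exists_congr fun i => h5 i A v⟩

theorem iInter {ι : Type} {R : ι → ∀ (A : Type) [L.Structure A], A → A → Prop}
    (hR : ∀ i, CDefinable L (R i)) : CDefinable L (fun A _ u v => ∀ i, R i A u v) := by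
  simpa using (iUnion fun i => (hR i).not).not

theorem or (hR : CDefinable L R) (hS : CDefinable L S) :
    CDefinable L (fun A _ u v => R A u v ∨ S A u v) := by
  have := iUnion (R := fun b : Bool => if b then R else S) (fun b => by cases b <;> simpa)
  simpa [or_comm] using this

theorem and (hR : CDefinable L R) (hS : CDefinable L S) :
    CDefinable L (fun A _ u v => R A u v ∧ S A u v) := by
  simpa [not_or] using (hR.not.or hS.not).not

theorem const (p : Prop) : CDefinable L (fun _ _ _ _ => p) := by
  have h : CDefinable L (fun _ _ u v => u = v ∨ ¬ u = v) := equal.or equal.not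
  by_cases hp : p
  · simpa [hp, em] using h
  · simpa [hp, em] using h.not

/-- The midpoint takes the only variable left. Quantifying it frees it for reuse, so compositions of
any length stay within three variables. -/
theorem comp (hR : CDefinable L R) (hS : CDefinable L S) :
    CDefinable L (fun A _ u v => ∃ w, R A u w ∧ S A w v) := fun x y hxy => by
  obtain ⟨z, hzx, hzy⟩ : ∃ z : Fin 3, x ≠ z ∧ y ≠ z := by
    revert x y; decide
  obtain ⟨φ, h3, h5⟩ := hR x z hzx
  obtain ⟨ψ, k3, k5⟩ := hS z y hzy.symm
  refine ⟨.exGe 1 z (.iAnd fun b : Bool => if b then φ else ψ), ?_, fun A _ v => ?_⟩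
  · rintro a ⟨ha, haz⟩
    obtain ⟨b, hb⟩ := Set.mem_iUnion.1 ha
    cases b
    · have := k3 hb
      simp_all
    · have := h3 hb
      simp_all
  · rw [CFormula.realize_exGe_one]
    simp [CFormula.Realize, h5, k5, Function.update_of_ne hzx, Function.update_of_ne hzy,
      and_comm]

theorem exists_sentence_not (hR : CDefinable L R) : ∃ φ : CSentence L 3,
    ∀ (A : Type) [L.Structure A] [Nonempty A], φ.Models A ↔ ¬ ∃ u v, R A u v := by
  obtain ⟨φ, h3, h5⟩ := hR 0 1 (by decide)
  refine ⟨⟨.neg (.exGe 1 0 (.exGe 1 1 φ)), ?_⟩, fun A _ _ => ?_⟩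
  · refine Set.eq_empty_of_forall_notMem ?_
    rintro a ⟨⟨ha, ha1⟩, ha0⟩
    have := h3 ha
    simp_all
  · have : ∀ (v : Fin 3 → A),
        (CFormula.neg (.exGe 1 0 (.exGe 1 1 φ))).Realize v ↔ ¬ ∃ u v, R A u v := fun v => by
      rw [CFormula.Realize, CFormula.realize_exGe_one]
      simp [CFormula.realize_exGe_one, h5]
    exact ⟨fun h => (this (fun _ => Classical.arbitrary A)).1 (h _), fun h v => (this v).2 h⟩

theorem transGen_prod {ι : Type}
    {E : ∀ (A : Type) [L.Structure A], A × ι → A × ι → Prop}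
    (hE : ∀ i j, CDefinable L (fun A _ u v => E A (u, i) (v, j))) (i j : ι) :
    CDefinable L (fun A _ u v => Relation.TransGen (E A) (u, i) (v, j)) := by
  -- `T n` is reachability by a walk of exactly `n + 1` edges.
  let T : ℕ → ∀ (A : Type) [L.Structure A], A × ι → A × ι → Prop :=
    fun n => Nat.rec E (fun _ T A _ p r => ∃ k m, T A p (m, k) ∧ E A (m, k) r) n
  have hT : ∀ n i j, CDefinable L (fun A _ u v => T n A (u, i) (v, j)) := by
    intro n
    induction n with
    | zero => exact hE
    | succ n ih => exact fun i j => iUnion fun k => (ih i k).comp (hE k j)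
  convert iUnion fun n => hT n i j using 6 with A _ u v
  constructor
  · intro huv
    generalize (v, j) = r at huv
    induction huv with
    | single h => exact ⟨0, h⟩
    | tail _ hbc ih =>
      obtain ⟨n, hn⟩ := ih
      exact ⟨n + 1, _, _, hn, hbc⟩
  · rintro ⟨n, hn⟩
    generalize (v, j) = r at hn
    induction n generalizing r with
    | zero => exact .single hn
    | succ n ih =>
      obtain ⟨k, m, hm, hr⟩ := hn
      exact (ih _ hm).tail hr

end CDefinable

end Definability

/-! ### The label-extended graph of an instance -/

section UniqueGames

variable {q : ℕ}

/-- The label-extended graph: `(u, i)` and `(v, j)` are adjacent if a constraint between `u` and `v`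
relates the labels `i` and `j`. -/
def labelAdj (A : Type) [(ugLang q).Structure A] (p r : A × Fin q) : Prop :=
  ∃ π : Equiv.Perm (Fin q),
    (FirstOrder.Language.Structure.RelMap (L := ugLang q) (UGRel.P π) ![p.1, r.1] ∧ π p.2 = r.2) ∨
    (FirstOrder.Language.Structure.RelMap (L := ugLang q) (UGRel.P π) ![r.1, p.1] ∧ π r.2 = p.2)

instance (A : Type) [(ugLang q).Structure A] : Std.Symm (labelAdj (q := q) A) :=
  ⟨fun _ _ ⟨π, h⟩ => ⟨π, h.symm⟩⟩

/-- Two elements are in conflict if they are equal and each label propagates, along some closed walk,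
to another label. -/
def Conflict (A : Type) [(ugLang q).Structure A] (u v : A) : Prop :=
  u = v ∧ ∀ i, ∃ j, i ≠ j ∧ Relation.TransGen (labelAdj (q := q) A) (u, i) (v, j)

theorem lfpDefinable_conflict :
    LFPDefinable (ugLang q) (fun A _ u v => Conflict (q := q) A u v) :=
  LFPDefinable.equal.and <| .iInter fun i => .iUnion fun j => (LFPDefinable.const (i ≠ j)).and <|
    LFPDefinable.transGen_prod (E := fun A _ => labelAdj A) (fun i j => .iUnion fun π =>
      ((LFPDefinable.relation (L := ugLang q) (UGRel.P π)).and (.const (π i = j))).or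
        ((LFPDefinable.relation (L := ugLang q) (UGRel.P π)).swap.and (.const (π j = i)))) i j

theorem cDefinable_conflict :
    CDefinable (ugLang q) (fun A _ u v => Conflict (q := q) A u v) :=
  CDefinable.equal.and <| .iInter fun i => .iUnion fun j => (CDefinable.const (i ≠ j)).and <|
    CDefinable.transGen_prod (E := fun A _ => labelAdj A) (fun i j => .iUnion fun π =>
      ((CDefinable.relation (L := ugLang q) (UGRel.P π)).and (.const (π i = j))).or
        ((CDefinable.relation (L := ugLang q) (UGRel.P π)).swap.and (.const (π j = i)))) i j

/-- Walks act on all labels simultaneously by a permutation. -/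
theorem exists_perm_of_reflTransGen {A : Type} [(ugLang q).Structure A] {p r : A × Fin q}
    (h : Relation.ReflTransGen (labelAdj (q := q) A) p r) :
    ∃ σ : Equiv.Perm (Fin q), σ p.2 = r.2 ∧
      ∀ i, Relation.ReflTransGen (labelAdj (q := q) A) (p.1, i) (r.1, σ i) := by
  induction h with
  | refl => exact ⟨1, rfl, fun _ => .refl⟩
  | tail _ hbc ih =>
    obtain ⟨σ, h1, h2⟩ := ih
    obtain ⟨π, ⟨hP, h⟩ | ⟨hP, h⟩⟩ := hbc
    · exact ⟨π * σ, by simp [h1, h], fun i => (h2 i).tail ⟨π, Or.inl ⟨hP, rfl⟩⟩⟩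
    · exact ⟨π⁻¹ * σ, by simp [h1, ← h], fun i => (h2 i).tail ⟨π, Or.inr ⟨hP, by simp⟩⟩⟩

theorem completelySatisfiable_iff (A : Type) [(ugLang q).Structure A] :
    CompletelySatisfiable q A ↔ ¬ ∃ u v : A, Conflict (q := q) A u v := by
  constructor
  · rintro ⟨f, hf⟩ ⟨u, v, rfl, h⟩
    obtain ⟨j, hj, huj⟩ := h (f u)
    have inv : ∀ r : A × Fin q, Relation.TransGen (labelAdj (q := q) A) (u, f u) r → r.2 = f r.1 := by
      have step : ∀ p r : A × Fin q, p.2 = f p.1 → labelAdj A p r → r.2 = f r.1 := by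
        rintro p r hp ⟨π, ⟨hP, h⟩ | ⟨hP, h⟩⟩
        · rw [← h, hf π _ _ hP, hp]
        · rw [hp, hf π _ _ hP] at h
          exact π.injective h
      intro r hr
      induction hr with
      | single h => exact step _ _ rfl h
      | tail _ hbc ih => exact step _ _ ih hbc
    exact hj (inv _ huj).symm
  · intro h
    -- Each variable has a label fixed by all closed walks. Such a label is chosen at one
    -- representative per component and transported along walks.
    have h' : ∀ u : A, ∃ i, ∀ j, Relation.ReflTransGen (labelAdj (q := q) A) (u, i) (u, j) → j = i := by
      intro u
      by_contra! hu
      refine h ⟨u, u, rfl, fun i => ?_⟩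
      obtain ⟨j, hj, hji⟩ := hu i
      refine ⟨j, hji.symm, ?_⟩
      rcases Relation.reflTransGen_iff_eq_or_transGen.1 hj with h | h
      · exact absurd (congrArg Prod.snd h) hji
      · exact h
    choose l hl using h'
    let s : Setoid A :=
      { r := fun u v => ∃ σ : Equiv.Perm (Fin q),
          ∀ i, Relation.ReflTransGen (labelAdj (q := q) A) (u, i) (v, σ i)
        iseqv :=
          { refl := fun u => ⟨1, fun i => .refl⟩
            symm := fun {u v} ⟨σ, hσ⟩ => ⟨σ⁻¹, fun i => by
              have := symm (hσ (σ⁻¹ i))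
              simpa using this⟩
            trans := fun ⟨σ, hσ⟩ ⟨τ, hτ⟩ => ⟨τ * σ, fun i => (hσ i).trans (hτ _)⟩ } }
    let rep : A → A := fun u => (Quotient.mk s u).out
    choose σ hσ using fun u => Quotient.mk_out (s := s) u
    -- Transport does not depend on the walk: going out along one walk and back along the other is a
    -- closed walk at `r`, which fixes `l r`.
    have uniq : ∀ (r v : A) (j j' : Fin q), Relation.ReflTransGen (labelAdj (q := q) A) (r, l r) (v, j) →
        Relation.ReflTransGen (labelAdj (q := q) A) (r, l r) (v, j') → j' = j := by
      intro r v j j' hj hj'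
      obtain ⟨τ, hτ, h⟩ := exists_perm_of_reflTransGen hj
      have hb := symm (h (τ.symm j'))
      simp only [Equiv.apply_symm_apply] at hb
      have := hl r _ (hj'.trans hb)
      exact ((Equiv.symm_apply_eq τ).1 this).trans hτ
    refine ⟨fun u => σ u (l (rep u)), fun π u v hP => ?_⟩
    have hadj : ∀ i, labelAdj A (u, i) (v, π i) := fun i => ⟨π, Or.inl ⟨hP, rfl⟩⟩
    have hrep : rep u = rep v :=
      congrArg Quotient.out (Quotient.sound (s := s) ⟨π, fun i => .single (hadj i)⟩)
    refine uniq (rep u) v _ _ ((hσ u (l (rep u))).tail (hadj _)) ?_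
    rw [hrep]
    exact hσ v _

/-! ### Permutation structures and two-variable equivalence -/

/-- The instance with the constraints `P_π(a, s a)`. -/
@[reducible] def permStructure (π : Equiv.Perm (Fin q)) {A : Type} (s : Equiv.Perm A) :
    (ugLang q).Structure A where
  funMap := fun f => f.elim
  RelMap := fun {_} R => match R with
    | .P τ => fun x => τ = π ∧ s (x 0) = x 1

/-- The hypotheses make `c`, `s c`, `s⁻¹ c` distinct, and likewise for `d`. As the symmetric group
is 3-transitive, `e` can be corrected to match these triples, which is all that the type relative to
`c` records. -/
theorem exists_equiv_of_perm {A B : Type} [Finite A] (e : A ≃ B) {s : Equiv.Perm A}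
    {t : Equiv.Perm B} (hs : ∀ a, s a ≠ a ∧ s (s a) ≠ a) (ht : ∀ b, t b ≠ b ∧ t (t b) ≠ b)
    (c : A) (d : B) : ∃ f : A ≃ B, ∀ a, (a = c ↔ f a = d) ∧ (s a = c ↔ t (f a) = d) ∧
      (s c = a ↔ t d = f a) := by
  classical
  have inj : ∀ {C : Type} (s : Equiv.Perm C) (c : C), (∀ a, s a ≠ a ∧ s (s a) ≠ a) →
      Function.Injective ![c, s c, s.symm c] := by
    intro C s c hs
    have h1 := (hs c).1
    have h2 := (hs (s.symm c)).1
    have h3 := (hs (s.symm c)).2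
    simp only [Equiv.apply_symm_apply] at h2 h3
    intro i j hij
    fin_cases i <;> fin_cases j <;> simp_all [eq_comm]
  have := Equiv.Perm.isMultiplyPretransitive B 3
  obtain ⟨g, hg⟩ := MulAction.exists_smul_eq (Equiv.Perm B)
    ((⟨_, inj s c hs⟩ : Fin 3 ↪ A).trans e.toEmbedding) ⟨_, inj t d ht⟩
  have h0 : g (e c) = d := DFunLike.congr_fun hg 0
  have h1 : g (e (s c)) = t d := DFunLike.congr_fun hg 1
  have h2 : g (e (s.symm c)) = t.symm d := DFunLike.congr_fun hg 2
  refine ⟨e.trans g, fun a => ⟨?_, ?_, ?_⟩⟩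
  · rw [← h0]; simp
  · rw [← Equiv.eq_symm_apply, ← Equiv.eq_symm_apply, ← h2]; simp
  · rw [← h1]; simp

/-- Assignments in two permutation structures with the same atomic type. -/
def SameType {A B : Type} (s : Equiv.Perm A) (t : Equiv.Perm B) {k : ℕ} (v : Fin k → A)
    (w : Fin k → B) : Prop :=
  ∀ i j, (v i = v j ↔ w i = w j) ∧ (s (v i) = v j ↔ t (w i) = w j)

/-- Duplicator's move in the bijective pebble game: with at most two variables, only one other
pebble has to be respected. -/
theorem SameType.exists_update {A B : Type} [Finite A] (e : A ≃ B) {s : Equiv.Perm A}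
    {t : Equiv.Perm B} (hs : ∀ a, s a ≠ a ∧ s (s a) ≠ a) (ht : ∀ b, t b ≠ b ∧ t (t b) ≠ b)
    {k : ℕ} (hk : k ≤ 2) {v : Fin k → A} {w : Fin k → B} (h : SameType s t v w) (x : Fin k) :
    ∃ f : A ≃ B, ∀ a, SameType s t (Function.update v x a) (Function.update w x (f a)) := by
  by_cases hy : ∃ y, y ≠ x
  · obtain ⟨y, hy⟩ := hy
    have hxy : ∀ i : Fin k, i = x ∨ i = y := by
      intro i
      have := x.2; have := y.2; have := i.2
      simp only [Fin.ext_iff, ne_eq] at *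
      omega
    obtain ⟨f, hf⟩ := exists_equiv_of_perm e hs ht (v y) (w y)
    refine ⟨f, fun a i j => ?_⟩
    obtain ⟨f1, f2, f3⟩ := hf a
    rcases hxy i with rfl | rfl <;> rcases hxy j with rfl | rfl
    · simp [(hs a).1, (ht _).1]
    · simpa [Function.update_of_ne hy] using ⟨f1, f2⟩
    · simpa [Function.update_of_ne hy] using ⟨by rw [eq_comm, f1, eq_comm], f3⟩
    · simpa [Function.update_of_ne hy] using (h j j).2
  · push Not at hy
    refine ⟨e, fun a i j => ?_⟩
    rw [hy i, hy j]
    simp [(hs a).1, (ht _).1]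

theorem SameType.realize_iff {A B : Type} [Finite A] (e : A ≃ B) (π : Equiv.Perm (Fin q))
    {s : Equiv.Perm A} {t : Equiv.Perm B} (hs : ∀ a, s a ≠ a ∧ s (s a) ≠ a)
    (ht : ∀ b, t b ≠ b ∧ t (t b) ≠ b) {k : ℕ} (hk : k ≤ 2) (φ : CFormula (ugLang q) k)
    {v : Fin k → A} {w : Fin k → B} (h : SameType s t v w) :
    (letI := permStructure π s; φ.Realize v) ↔ (letI := permStructure π t; φ.Realize w) := by
  induction φ generalizing v w with
  | eq x y => exact (h x y).1
  | rel R x =>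
    cases R with
    | P τ => exact and_congr_right fun _ => (h (x 0) (x 1)).2
  | neg φ ih => exact not_congr (ih h)
  | iAnd φ ih => exact forall_congr' fun i => ih i h
  | iOr φ ih => exact exists_congr fun i => ih i h
  | exGe m x φ ih =>
    -- One bijection serves all `a` at once, so it carries witnesses onto witnesses and preserves
    -- their number.
    obtain ⟨f, hf⟩ := h.exists_update e hs ht hk x
    simp only [CFormula.Realize]
    rw [← f.injective.encard_image, Equiv.image_eq_preimage_symm]
    refine Iff.of_eq (congrArg (fun S : Set B => (m : ℕ∞) ≤ S.encard) ?_)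
    ext b
    have := ih (hf (f.symm b))
    rw [Equiv.apply_symm_apply] at this
    exact this

theorem models_of_models {A B : Type} [Finite A] (e : A ≃ B) (π : Equiv.Perm (Fin q))
    {s : Equiv.Perm A} {t : Equiv.Perm B} (hs : ∀ a, s a ≠ a ∧ s (s a) ≠ a)
    (ht : ∀ b, t b ≠ b ∧ t (t b) ≠ b) {k : ℕ} (hk : k ≤ 2) (ψ : CSentence (ugLang q) k)
    (h : letI := permStructure π s; ψ.Models A) : letI := permStructure π t; ψ.Models B := by
  intro w
  suffices ∃ v : Fin k → A, SameType s t v w by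
    obtain ⟨v, hv⟩ := this
    exact (hv.realize_iff e π hs ht hk ψ.formula).1 (h v)
  rcases k with _ | k
  · exact ⟨Fin.elim0, fun i => i.elim0⟩
  -- Constant assignments have the same type because there are no fixed points; one pebble move then
  -- reaches `w`.
  · have h0 : SameType s t (fun _ : Fin (k + 1) => e.symm (w 0)) (fun _ => w 0) := fun i j => by
      simp [(hs _).1, (ht _).1]
    by_cases hk1 : k = 0
    · subst hk1
      exact ⟨_, by convert h0 using 2 with i; exact congrArg w (Fin.eq_zero i)⟩
    · obtain rfl : k = 1 := by omega
      obtain ⟨f, hf⟩ := h0.exists_update e hs ht hk 1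
      refine ⟨Function.update (fun _ => e.symm (w 0)) 1 (f.symm (w 1)), ?_⟩
      convert hf (f.symm (w 1)) using 1
      funext i
      fin_cases i <;> simp

/-- Every constraint shifts the label by 1, so a cycle is satisfiable exactly when the number of
labels divides its length. -/
theorem three_le_of_translatableInto (hq : 2 ≤ q) (φ : LFPSentence (ugLang q))
    (hφ : ∀ (A : Type) [(ugLang q).Structure A] [Finite A] [Nonempty A],
      φ.Models A ↔ CompletelySatisfiable q A) {k : ℕ} (hk : φ.TranslatableInto k) : 3 ≤ k := by
  by_contra! hk3
  obtain ⟨ψ, hψ⟩ := hk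
  -- From here there are `q + 2` labels. The length `q + 3` is at least 3 and is 1 modulo `q + 2`;
  -- `q + 2` such cycles have as many points as one cycle of length `(q + 2) * (q + 3)`.
  obtain ⟨q, rfl⟩ : ∃ p, q = p + 2 := ⟨q - 2, by omega⟩
  have : NeZero ((q + 2) * (q + 3)) := ⟨by positivity⟩
  let π : Equiv.Perm (Fin (q + 2)) := Equiv.addRight 1
  let s : Equiv.Perm (ZMod ((q + 2) * (q + 3))) := Equiv.addRight 1
  let t : Equiv.Perm (Fin (q + 2) × ZMod (q + 3)) := (Equiv.refl _).prodCongr (Equiv.addRight 1)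
  have small : ∀ (n : ℕ), 3 ≤ n → (1 : ZMod n) ≠ 0 ∧ (1 + 1 : ZMod n) ≠ 0 := by
    intro n hn
    constructor
    · rw [← Nat.cast_one, Ne, ZMod.natCast_eq_zero_iff]
      exact fun h => absurd (Nat.le_of_dvd one_pos h) (by omega)
    · rw [one_add_one_eq_two, ← Nat.cast_ofNat, Ne, ZMod.natCast_eq_zero_iff]
      exact fun h => absurd (Nat.le_of_dvd two_pos h) (by omega)
  have hs : ∀ a, s a ≠ a ∧ s (s a) ≠ a := fun a => by
    have := small ((q + 2) * (q + 3)) (by nlinarith)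
    simpa [s, add_assoc] using this
  have ht : ∀ b, t b ≠ b ∧ t (t b) ≠ b := fun b => by
    have := small (q + 3) (by omega)
    simpa [t, Prod.ext_iff, add_assoc] using this
  have e : ZMod ((q + 2) * (q + 3)) ≃ Fin (q + 2) × ZMod (q + 3) := by
    refine Fintype.equivOfCardEq ?_
    simp [ZMod.card]
  have sat : letI := permStructure π s; CompletelySatisfiable (q + 2) (ZMod ((q + 2) * (q + 3))) := by
    refine ⟨ZMod.castHom (Dvd.intro _ rfl) (ZMod (q + 2)), ?_⟩
    rintro τ u v ⟨rfl, h⟩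
    have h' : u + 1 = v := h
    rw [← h', map_add, map_one]
    rfl
  have unsat : letI := permStructure π t;
      ¬ CompletelySatisfiable (q + 2) (Fin (q + 2) × ZMod (q + 3)) := by
    rintro ⟨f, hf⟩
    let g : ZMod (q + 3) → ZMod (q + 2) := fun n => f (0, n)
    have step : ∀ n : ℕ, g n = g 0 + n := by
      intro n
      induction n with
      | zero => simp
      | succ n ih =>
        have h : g ((n : ZMod (q + 3)) + 1) = g n + 1 := hf π (0, n) (0, n + 1) ⟨rfl, rfl⟩
        rw [Nat.cast_succ, Nat.cast_succ, ← add_assoc, ← ih, h]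
    -- Once around a short cycle the label has grown by `q + 3`, which is 1 modulo `q + 2`.
    have h := step (q + 2 + 1)
    rw [ZMod.natCast_self, Nat.cast_succ, ZMod.natCast_self, zero_add, left_eq_add] at h
    have : Fact (1 < q + 2) := ⟨by omega⟩
    exact one_ne_zero h
  refine unsat ?_
  let := permStructure π t
  refine (hφ _).1 ((hψ _).2 (models_of_models e π hs ht (by omega) ψ ?_))
  let := permStructure π s
  exact (hψ _).1 ((hφ _).2 sat)

end UniqueGames

theorem mainTheorem7 (q : ℕ) (hq : 1 ≤ q) :
    ∃ φ : LFPSentence (ugLang q),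
      (∀ (A : Type) [(ugLang q).Structure A] [Finite A] [Nonempty A],
        φ.Models A ↔ CompletelySatisfiable q A) ∧
      φ.mu ≤ 3 ∧ (2 ≤ q → φ.mu = 3) := by
  obtain ⟨φ, hφ⟩ := LFPDefinable.exists_sentence_not (lfpDefinable_conflict (q := q))
  obtain ⟨ψ, hψ⟩ := CDefinable.exists_sentence_not (cDefinable_conflict (q := q))
  have hsat : ∀ (A : Type) [(ugLang q).Structure A] [Finite A] [Nonempty A],
      φ.Models A ↔ CompletelySatisfiable q A := fun A _ _ _ => by
    rw [hφ, completelySatisfiable_iff]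
  have hle : φ.mu ≤ 3 := sInf_le ⟨3, ⟨ψ, fun A _ _ _ => by rw [hφ, hψ]⟩, rfl⟩
  refine ⟨φ, hsat, hle, fun h2 => le_antisymm hle (le_sInf ?_)⟩
  rintro _ ⟨k, hk, rfl⟩
  exact Nat.cast_le.2 (three_le_of_translatableInto h2 φ hsat hk)
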